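/- Let $n\ge 0$ be an integer, let $q$ be a formal parameter and $\varepsilon=q-q^{-1}\in\mathbb C(q)$. Let $\widehat{\mathcal H}_n^-$ be the spin affine Hecke algebra, that is, the associative unital $\mathbb C(q)$-algebra with generators $R_i$ $(1\le i\le n-1)$ and $p_j,q_j$ $(1\le j\le n)$ and relations $$R_i^2=-\varepsilon^2-2,\qquad R_iR_j=-R_jR_i\ (|i-j|>1),\qquad R_iR_{i+1}R_i-R_{i+1}R_iR_{i+1}=\varepsilon^2(R_{i+1}-R_i),$$ $$p_ip_j=p_jp_i,\quad p_iq_j=q_jp_i\ (\text{all } i,j),\qquad q_iq_j=-q_jq_i\ (i\ne j),\qquad p_i^2+q_i^2=1,$$ $$R_ip_j=p_jR_i,\qquad R_iq_j=-q_jR_i\qquad (j\ne i,i+1),$$ $$R_ip_i=p_{i+1}R_i+\varepsilon(q_i-q_{i+1}),\qquad R_iq_i=-q_{i+1}R_i-\varepsilon(p_i+p_{i+1}).$$ The element $\delta=\prod_{1\le i<j\le n}(p_i-p_j)^2$ is central; let $(\widehat{\mathcal H}_n^-)_\delta$ be the localization of $\widehat{\mathcal H}_n^-$ at the powers of $\delta$.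 In it every $p_i-p_{i+1}$ is invertible; define $$\gimel_i=R_i-\varepsilon\,(p_i-p_{i+1})^{-1}(q_i-q_{i+1})\in(\widehat{\mathcal H}_n^-)_\delta\qquad(1\le i\le n-1).$$ **Proposition.** In $(\widehat{\mathcal H}_n^-)_\delta$ the elements $\gimel_i$ satisfy $$\gimel_i^2=-2+2\varepsilon^2\,(p_i-p_{i+1})^{-2}(p_ip_{i+1}-1)\qquad(1\le i\le n-1),$$ $$\gimel_i\gimel_{i+1}\gimel_i=\gimel_{i+1}\gimel_i\gimel_{i+1}\qquad(1\le i\le n-2),\qquad\qquad \gimel_i\gimel_j=-\gimel_j\gimel_i\qquad(|i-j|>1),$$ $$\gimel_ip_i=p_{i+1}\gimel_i,\qquad \gimel_ip_{i+1}=p_i\gimel_i,$$ $$\gimel_ip_j=p_j\gimel_i,\qquad \gimel_iq_j=-q_j\gimel_i\qquad(j\ne i,i+1),$$ $$\gimel_iq_i=-q_{i+1}\gimel_i,\qquad \gimel_iq_{i+1}=-q_i\gimel_i.$$ -/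

import Mathlib

noncomputable section

namespace SpinAffineHecke

open OreLocalization

/-- The ground field `ℂ(q)`. -/
abbrev K : Type := RatFunc ℂ

/-- `ε = q - q⁻¹`. -/
def ε : K := RatFunc.X - RatFunc.X⁻¹

/-- The generators. Indices start at `0`: for `i : Fin (n - 1)` the element `R i` is the one
usually written `R_{i+1}`, and for `j : Fin n` the elements `p j`, `q j` are `p_{j+1}`, `q_{j+1}`. -/
inductive Gen (n : ℕ) : Type
  | R : Fin (n - 1) → Gen n
  | p : Fin n → Gen n
  | q : Fin n → Gen n

/-- The index `i` of `R_i`, as an index of the `p`'s and `q`'s. -/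
def lo {n : ℕ} (i : Fin (n - 1)) : Fin n := ⟨i, by omega⟩

/-- The index `i + 1`, as an index of the `p`'s and `q`'s. -/
def hi {n : ℕ} (i : Fin (n - 1)) : Fin n := ⟨i + 1, by omega⟩

/-- The condition `|i - j| > 1`. -/
def Far {n : ℕ} (i j : Fin (n - 1)) : Prop := 1 < |((i : ℕ) : ℤ) - ((j : ℕ) : ℤ)|

section Relations

variable {n : ℕ}

/-- The generator `R_i` of the free algebra. -/
def fR (i : Fin (n - 1)) : FreeAlgebra K (Gen n) := FreeAlgebra.ι K (Gen.R i)

/-- The generator `p_j` of the free algebra. -/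
def fp (j : Fin n) : FreeAlgebra K (Gen n) := FreeAlgebra.ι K (Gen.p j)

/-- The generator `q_j` of the free algebra. -/
def fq (j : Fin n) : FreeAlgebra K (Gen n) := FreeAlgebra.ι K (Gen.q j)

end Relations

/-- The defining relations of the spin affine Hecke algebra. -/
inductive Rel (n : ℕ) : FreeAlgebra K (Gen n) → FreeAlgebra K (Gen n) → Prop
  | R_sq (i : Fin (n - 1)) :
      Rel n (fR i ^ 2) (algebraMap K (FreeAlgebra K (Gen n)) (-ε ^ 2 - 2))
  | R_far (i j : Fin (n - 1)) (h : Far i j) :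
      Rel n (fR i * fR j) (-(fR j * fR i))
  | R_braid (i j : Fin (n - 1)) (h : (j : ℕ) = i + 1) :
      Rel n (fR i * fR j * fR i - fR j * fR i * fR j) (ε ^ 2 • (fR j - fR i))
  | p_comm (i j : Fin n) : Rel n (fp i * fp j) (fp j * fp i)
  | q_anticomm (i j : Fin n) (h : i ≠ j) : Rel n (fq i * fq j) (-(fq j * fq i))
  | p_sq_add_q_sq (i : Fin n) : Rel n (fp i ^ 2 + fq i ^ 2) 1
  | p_q (i j : Fin n) : Rel n (fp i * fq j) (fq j * fp i)
  | R_p_far (i : Fin (n - 1)) (j : Fin n) (h : j ≠ lo i) (h' : j ≠ hi i) :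
      Rel n (fR i * fp j) (fp j * fR i)
  | R_q_far (i : Fin (n - 1)) (j : Fin n) (h : j ≠ lo i) (h' : j ≠ hi i) :
      Rel n (fR i * fq j) (-(fq j * fR i))
  | R_p (i : Fin (n - 1)) :
      Rel n (fR i * fp (lo i)) (fp (hi i) * fR i + ε • (fq (lo i) - fq (hi i)))
  | R_q (i : Fin (n - 1)) :
      Rel n (fR i * fq (lo i)) (-(fq (hi i) * fR i) - ε • (fp (lo i) + fp (hi i)))

/-- The spin affine Hecke algebra: the `ℂ(q)`-algebra presented by `Gen` and `Rel`. -/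
def H (n : ℕ) : Type := RingQuot (Rel n)

instance instRingH (n : ℕ) : Ring (H n) := inferInstanceAs (Ring (RingQuot (Rel n)))

instance instAlgebraH (n : ℕ) : Algebra K (H n) :=
  inferInstanceAs (Algebra K (RingQuot (Rel n)))

/-- The quotient map from the free algebra. -/
def mk (n : ℕ) : FreeAlgebra K (Gen n) →ₐ[K] H n := RingQuot.mkAlgHom K (Rel n)

theorem mk_rel {n : ℕ} {x y : FreeAlgebra K (Gen n)} (h : Rel n x y) : mk n x = mk n y :=
  RingQuot.mkAlgHom_rel K h

theorem mk_surjective (n : ℕ) : Function.Surjective (mk n) :=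
  RingQuot.mkAlgHom_surjective K (Rel n)

variable {n : ℕ}

/-- The generator `R_i` of the spin affine Hecke algebra. -/
def R (i : Fin (n - 1)) : H n := mk n (fR i)

/-- The generator `p_j` of the spin affine Hecke algebra. -/
def p (j : Fin n) : H n := mk n (fp j)

/-- The generator `q_j` of the spin affine Hecke algebra. -/
def q (j : Fin n) : H n := mk n (fq j)

theorem p_comm (i j : Fin n) : p i * p j = p j * p i := by
  simpa [p] using mk_rel (Rel.p_comm i j)

theorem p_q (i j : Fin n) : p i * q j = q j * p i := by
  simpa [p, q] using mk_rel (Rel.p_q i j)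

theorem R_sq (i : Fin (n - 1)) : R i ^ 2 = algebraMap K (H n) (-ε ^ 2 - 2) := by
  have h := mk_rel (Rel.R_sq i)
  rw [map_pow, AlgHom.commutes] at h
  exact h

theorem R_p_far (i : Fin (n - 1)) (j : Fin n) (h : j ≠ lo i) (h' : j ≠ hi i) :
    R i * p j = p j * R i := by
  simpa [p, R] using mk_rel (Rel.R_p_far i j h h')

theorem R_p (i : Fin (n - 1)) :
    R i * p (lo i) = p (hi i) * R i + ε • (q (lo i) - q (hi i)) := by
  simpa [p, q, R] using mk_rel (Rel.R_p i)

theorem R_q (i : Fin (n - 1)) :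
    R i * q (lo i) = -(q (hi i) * R i) - ε • (p (lo i) + p (hi i)) := by
  simpa [p, q, R] using mk_rel (Rel.R_q i)

/-- A computation in an arbitrary algebra over a field of characteristic not two. -/
theorem mul_p_hi_aux {F A : Type*} [Field F] [Ring A] [Algebra F A] (h2' : (2 : F) ≠ 0)
    {e : F} {r a b s t : A} (h1 : r * a = b * r + e • (s - t))
    (h2 : r * s = -(t * r) - e • (a + b)) (h3 : r * r = (-e ^ 2 - 2) • (1 : A)) :
    r * b = a * r - e • (s - t) := by
  have h3' : ∀ z : A, r * (r * z) = (-e ^ 2 - 2) • z := by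
    intro z
    rw [← mul_assoc, h3, smul_mul_assoc, one_mul]
  have h3'' : ∀ z : A, z * r * r = (-e ^ 2 - 2) • z := by
    intro z
    rw [mul_assoc, h3, mul_smul_comm, mul_one]
  obtain ⟨U, hU⟩ : ∃ U, U = r * b - a * r + e • (s - t) := ⟨_, rfl⟩
  obtain ⟨V, hV⟩ : ∃ V, V = r * t + s * r + e • (a + b) := ⟨_, rfl⟩
  have e1 := h3' a
  rw [h1, mul_add, mul_smul_comm, mul_sub, h2, ← mul_assoc] at e1
  have e2 := h3' s
  rw [h2, mul_sub, mul_neg, mul_smul_comm, mul_add, h1, ← mul_assoc] at e2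
  have f1 : U * r = e • V := by
    rw [hU, hV, add_mul, sub_mul, h3'', ← e1, smul_mul_assoc, sub_mul]
    module
  have f2 : V * r = -(e • U) := by
    rw [hU, hV, add_mul, add_mul, h3'', ← e2, smul_mul_assoc, add_mul]
    module
  have f3 := h3'' U
  rw [f1, smul_mul_assoc, f2] at f3
  have f4 : (2 : F) • U = 0 := by
    have : (2 : F) • U = e • -(e • U) - (-e ^ 2 - 2) • U := by module
    rw [this, f3, sub_self]
  have f5 : U = 0 := (smul_eq_zero.mp f4).resolve_left h2'
  rw [f5] at hU
  have : r * b = (r * b - a * r + e • (s - t)) + (a * r - e • (s - t)) := by module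
  rw [this, ← hU, zero_add]

theorem R_mul_p_hi (i : Fin (n - 1)) :
    R i * p (hi i) = p (lo i) * R i - ε • (q (lo i) - q (hi i)) := by
  refine mul_p_hi_aux two_ne_zero (R_p i) (R_q i) ?_
  rw [← sq, R_sq, Algebra.algebraMap_eq_smul_one]

open scoped IsMulCommutative in
/-- Evaluation of polynomials at `p_1, …, p_n`. -/
theorem exists_evalP (n : ℕ) :
    ∃ φ : MvPolynomial (Fin n) K →ₐ[K] H n, ∀ j, φ (MvPolynomial.X j) = p j := by
  have hc : ∀ a ∈ Set.range (p : Fin n → H n), ∀ b ∈ Set.range (p : Fin n → H n),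
      a * b = b * a := by
    rintro _ ⟨i, rfl⟩ _ ⟨j, rfl⟩
    exact p_comm i j
  have := Algebra.isMulCommutative_adjoin K hc
  let f : Fin n → Algebra.adjoin K (Set.range (p : Fin n → H n)) :=
    fun j => ⟨p j, Algebra.subset_adjoin ⟨j, rfl⟩⟩
  exact ⟨(Subalgebra.val _).comp (MvPolynomial.aeval f), fun j => by simp [f]⟩

theorem evalP_comm_q {φ : MvPolynomial (Fin n) K →ₐ[K] H n}
    (hφ : ∀ j, φ (MvPolynomial.X j) = p j) (f : MvPolynomial (Fin n) K) (k : Fin n) :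
    q k * φ f = φ f * q k := by
  induction f using MvPolynomial.induction_on with
  | C a =>
    rw [← MvPolynomial.algebraMap_eq, AlgHom.commutes]
    exact (Algebra.commutes a _).symm
  | add f g hf hg => rw [map_add, mul_add, add_mul, hf, hg]
  | mul_X f j hf => rw [map_mul, hφ, ← mul_assoc, hf, mul_assoc, mul_assoc, p_q]

theorem evalP_skew {φ : MvPolynomial (Fin n) K →ₐ[K] H n}
    (hφ : ∀ j, φ (MvPolynomial.X j) = p j) (i : Fin (n - 1)) (f : MvPolynomial (Fin n) K) :
    ∃ g : MvPolynomial (Fin n) K,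
      f - MvPolynomial.rename (Equiv.swap (lo i) (hi i)) f =
        (MvPolynomial.X (lo i) - MvPolynomial.X (hi i)) * g ∧
      R i * φ f = φ (MvPolynomial.rename (Equiv.swap (lo i) (hi i)) f) * R i +
        ε • (φ g * (q (lo i) - q (hi i))) := by
  induction f using MvPolynomial.induction_on with
  | C a =>
    refine ⟨0, by simp, ?_⟩
    rw [MvPolynomial.rename_C, ← MvPolynomial.algebraMap_eq, AlgHom.commutes,
      ← Algebra.commutes a (R i)]
    simp
  | add f g hf hg =>
    obtain ⟨u, hu, hu'⟩ := hf
    obtain ⟨v, hv, hv'⟩ := hg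
    refine ⟨u + v, ?_, ?_⟩
    · rw [map_add, mul_add, ← hu, ← hv]
      ring
    · rw [map_add, mul_add, hu', hv', map_add, map_add, map_add, add_mul, add_mul, smul_add]
      abel
  | mul_X f j hf =>
    obtain ⟨u, hu, hu'⟩ := hf
    obtain ⟨v, hv, hv'⟩ : ∃ v : MvPolynomial (Fin n) K,
        MvPolynomial.X j - MvPolynomial.X (Equiv.swap (lo i) (hi i) j) =
          (MvPolynomial.X (lo i) - MvPolynomial.X (hi i)) * v ∧
        R i * p j = p (Equiv.swap (lo i) (hi i) j) * R i +
          ε • (φ v * (q (lo i) - q (hi i))) := by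
      by_cases h1 : j = lo i
      · subst h1
        refine ⟨1, by simp, ?_⟩
        rw [Equiv.swap_apply_left, R_p, map_one, one_mul]
      · by_cases h2 : j = hi i
        · subst h2
          refine ⟨-1, by simp, ?_⟩
          rw [Equiv.swap_apply_right, R_mul_p_hi, map_neg, map_one, neg_one_mul, smul_neg,
            sub_eq_add_neg]
        · refine ⟨0, by simp [Equiv.swap_apply_of_ne_of_ne h1 h2], ?_⟩
          rw [Equiv.swap_apply_of_ne_of_ne h1 h2, R_p_far i j h1 h2]
          simp
    have hx : (q (lo i) - q (hi i)) * p j = p j * (q (lo i) - q (hi i)) := by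
      rw [sub_mul, mul_sub, p_q, p_q]
    refine ⟨MvPolynomial.rename (Equiv.swap (lo i) (hi i)) f * v + u * MvPolynomial.X j, ?_, ?_⟩
    · rw [map_mul, MvPolynomial.rename_X]
      linear_combination MvPolynomial.X j * hu +
        MvPolynomial.rename (Equiv.swap (lo i) (hi i)) f * hv
    · rw [map_mul, ← mul_assoc, hu', add_mul, mul_assoc, hφ, hv', map_mul, map_add, map_mul,
        map_mul, map_mul, MvPolynomial.rename_X, hφ, hφ, smul_mul_assoc, mul_assoc, hx, mul_add,
        mul_smul_comm, add_mul, smul_add]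
      simp only [mul_assoc]
      abel

theorem evalP_comm_R {φ : MvPolynomial (Fin n) K →ₐ[K] H n}
    (hφ : ∀ j, φ (MvPolynomial.X j) = p j) (i : Fin (n - 1)) (f : MvPolynomial (Fin n) K)
    (hf : MvPolynomial.rename (Equiv.swap (lo i) (hi i)) f = f) :
    R i * φ f = φ f * R i := by
  obtain ⟨g, hg, hg'⟩ := evalP_skew hφ i f
  rw [hf, sub_self] at hg
  have hne : (MvPolynomial.X (lo i) - MvPolynomial.X (hi i) : MvPolynomial (Fin n) K) ≠ 0 := by
    intro h
    have := MvPolynomial.X_injective (sub_eq_zero.mp h)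
    simp [lo, hi, Fin.ext_iff] at this
  have hg0 : g = 0 := (mul_eq_zero.mp hg.symm).resolve_left hne
  rw [hg', hf, hg0]
  simp

/-- An element that commutes with all generators is central. -/
theorem central_of_gen (z : H n) (hR : ∀ i, R i * z = z * R i) (hp : ∀ j, p j * z = z * p j)
    (hq : ∀ j, q j * z = z * q j) (x : H n) : x * z = z * x := by
  obtain ⟨y, rfl⟩ := mk_surjective n x
  induction y using FreeAlgebra.induction with
  | grade0 r =>
    rw [AlgHom.commutes]
    exact Algebra.commutes r z
  | grade1 g =>
    cases g with
    | R i => exact hR i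
    | p j => exact hp j
    | q j => exact hq j
  | mul a b ha hb => rw [map_mul, mul_assoc, hb, ← mul_assoc, ha, mul_assoc]
  | add a b ha hb => rw [map_add, add_mul, mul_add, ha, hb]

/-- The pairs `(i, j)` with `i < j`. -/
def pairs (n : ℕ) : Finset (Fin n × Fin n) := Finset.univ.filter fun x => x.1 < x.2

theorem commute_p_sub (i j k l : Fin n) : Commute (p i - p j) (p k - p l) :=
  (Commute.sub_right (p_comm i k) (p_comm i l)).sub_left
    (Commute.sub_right (p_comm j k) (p_comm j l))

/-- `δ = ∏_{i < j} (p_i - p_j)²` (the factors commute with each other). -/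
def δ (n : ℕ) : H n :=
  (pairs n).noncommProd (fun x => (p x.1 - p x.2) ^ 2)
    fun _ _ _ _ _ => (commute_p_sub _ _ _ _).pow_pow 2 2

/-- The polynomial whose value at the `p`'s is `δ`. -/
def discPoly (n : ℕ) : MvPolynomial (Fin n) K :=
  ∏ x ∈ pairs n, (MvPolynomial.X x.1 - MvPolynomial.X x.2) ^ 2

theorem evalP_discPoly {φ : MvPolynomial (Fin n) K →ₐ[K] H n}
    (hφ : ∀ j, φ (MvPolynomial.X j) = p j) : φ (discPoly n) = δ n := by
  have h := Finset.map_noncommProd (pairs n)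
    (fun x => (MvPolynomial.X x.1 - MvPolynomial.X x.2 : MvPolynomial (Fin n) K) ^ 2)
    (fun _ _ _ _ _ => Commute.all _ _) φ
  rw [Finset.noncommProd_eq_prod] at h
  rw [discPoly, h, δ]
  apply Finset.noncommProd_congr rfl
  intro x _
  rw [map_pow, map_sub, hφ, hφ]

theorem discPoly_eq_det (n : ℕ) :
    discPoly n = (Matrix.vandermonde (MvPolynomial.X : Fin n → MvPolynomial (Fin n) K)).det ^ 2 := by
  rw [Matrix.det_vandermonde, Finset.prod_sigma', ← Finset.prod_pow, discPoly]
  refine Finset.prod_bij' (fun x _ => ⟨x.1, x.2⟩) (fun x _ => (x.1, x.2)) ?_ ?_ ?_ ?_ ?_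
  · intro x hx
    simpa [pairs] using hx
  · intro x hx
    simpa [pairs] using hx
  · intro x _
    rfl
  · intro x _
    rfl
  · intro x _
    ring

theorem rename_discPoly (σ : Equiv.Perm (Fin n)) :
    MvPolynomial.rename σ (discPoly n) = discPoly n := by
  rw [discPoly_eq_det, map_pow, AlgHom.map_det]
  have : (MvPolynomial.rename σ).mapMatrix
      (Matrix.vandermonde (MvPolynomial.X : Fin n → MvPolynomial (Fin n) K)) =
      (Matrix.vandermonde (MvPolynomial.X : Fin n → MvPolynomial (Fin n) K)).submatrix σ id := by
    ext1 i j
    simp [Matrix.vandermonde_apply]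
  rw [this, Matrix.det_permute, mul_pow, ← Int.cast_pow, ← Units.val_pow_eq_pow_val,
    Int.units_sq]
  simp

/-- The element `δ` is central. -/
theorem δ_central (x : H n) : x * δ n = δ n * x := by
  obtain ⟨φ, hφ⟩ := exists_evalP n
  rw [← evalP_discPoly hφ]
  refine central_of_gen _ (fun i => evalP_comm_R hφ i _ (rename_discPoly _)) (fun j => ?_)
    (fun j => evalP_comm_q hφ _ j) x
  rw [← hφ, ← map_mul, ← map_mul, mul_comm]

theorem powers_central (s : Submonoid.powers (δ n)) (x : H n) : x * s = s * x := by
  obtain ⟨_, k, rfl⟩ := s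
  exact (show Commute x (δ n) from δ_central x).pow_right k

instance oreSetPowers : OreSet (Submonoid.powers (δ n)) where
  ore_right_cancel r₁ r₂ s h := ⟨s, by rw [← powers_central, ← powers_central, h]⟩
  oreNum r _ := r
  oreDenom _ s := s
  ore_eq r s := (powers_central s r).symm

/-- The localization of the spin affine Hecke algebra at `δ`, that is, at the central
multiplicative set of the powers of `δ`. -/
def HLoc (n : ℕ) : Type := OreLocalization (Submonoid.powers (δ n)) (H n)

instance instRingHLoc (n : ℕ) : Ring (HLoc n) :=
  inferInstanceAs (Ring (OreLocalization (Submonoid.powers (δ n)) (H n)))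

instance instAlgebraHLoc (n : ℕ) : Algebra K (HLoc n) :=
  inferInstanceAs (Algebra K (OreLocalization (Submonoid.powers (δ n)) (H n)))

/-- The canonical ring homomorphism from the spin affine Hecke algebra to its localization. -/
def toLoc (n : ℕ) : H n →+* HLoc n :=
  (numeratorRingHom : H n →+* OreLocalization (Submonoid.powers (δ n)) (H n))

theorem isUnit_toLoc_δ (n : ℕ) : IsUnit (toLoc n (δ n)) :=
  numerator_isUnit (⟨δ n, Submonoid.mem_powers _⟩ : Submonoid.powers (δ n))

/-- The image of `R_i` in the localization. -/
def R' (i : Fin (n - 1)) : HLoc n := toLoc n (R i)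

/-- The image of `p_j` in the localization. -/
def p' (j : Fin n) : HLoc n := toLoc n (p j)

/-- The image of `q_j` in the localization. -/
def q' (j : Fin n) : HLoc n := toLoc n (q j)

theorem X_sub_dvd_discPoly {i j : Fin n} (h : i < j) :
    (MvPolynomial.X i - MvPolynomial.X j : MvPolynomial (Fin n) K) ∣ discPoly n := by
  have hm : (i, j) ∈ pairs n := by simpa [pairs] using h
  have h1 := Finset.dvd_prod_of_mem (fun x : Fin n × Fin n =>
        (MvPolynomial.X x.1 - MvPolynomial.X x.2 : MvPolynomial (Fin n) K) ^ 2) hm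
  refine dvd_trans ?_ h1
  exact Dvd.intro_left _ (sq _).symm

theorem exists_δ_eq {i j : Fin n} (h : i < j) :
    ∃ z : H n, δ n = (p i - p j) * z ∧ Commute (p i - p j) z := by
  obtain ⟨φ, hφ⟩ := exists_evalP n
  obtain ⟨g, hg⟩ := X_sub_dvd_discPoly h
  have hd : φ (MvPolynomial.X i - MvPolynomial.X j) = p i - p j := by
    rw [map_sub, hφ, hφ]
  refine ⟨φ g, ?_, ?_⟩
  · rw [← evalP_discPoly hφ, hg, map_mul, hd]
  · rw [← hd]
    exact (Commute.all _ _).map φ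

theorem isUnit_p_sub {i j : Fin n} (h : i < j) : IsUnit (p' i - p' j) := by
  obtain ⟨z, hz, hc⟩ := exists_δ_eq h
  have h1 := isUnit_toLoc_δ n
  rw [hz, map_mul, (hc.map (toLoc n)).isUnit_mul_iff, map_sub] at h1
  exact h1.1

theorem lo_lt_hi (i : Fin (n - 1)) : lo i < hi i := Fin.lt_def.mpr (Nat.lt_succ_self _)

/-- The element `p_i - p_{i+1}` of the localization, as a unit. -/
def diff (i : Fin (n - 1)) : (HLoc n)ˣ := (isUnit_p_sub (lo_lt_hi i)).unit

theorem diff_val (i : Fin (n - 1)) : (diff i : HLoc n) = p' (lo i) - p' (hi i) := rfl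

/-- The intertwiner `ℷ_i = R_i - ε (p_i - p_{i+1})⁻¹ (q_i - q_{i+1})`. -/
def gimel (i : Fin (n - 1)) : HLoc n :=
  R' i - ε • (((diff i)⁻¹ : (HLoc n)ˣ) * (q' (lo i) - q' (hi i)))

end SpinAffineHecke

end

/-! Put x_{kl} = (p_k - p_l)⁻¹ (q_k - q_l), which is symmetric in k and l, so that R_i = ℷ_i + ε
x_{i,i+1}. The correction is exactly what cancels the inhomogeneous terms in the relations of R_i
with p and q, since p_i = (p_i - p_{i+1}) + p_{i+1} and q_i² - q_{i+1}² = p_{i+1}² - p_i². Hence ℷ_i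
permutes the indices of the p's, and those of the q's up to sign, and so it carries x_{kl} to minus
the permuted fraction (`gimel_mul_fraction`).

In particular ℷ_i anticommutes with x_{i,i+1}, so the cross terms in R_i² vanish and ℷ_i² = R_i² -
ε² x_{i,i+1}², where the last square involves only the p's.

For the braid relation, substitute R = ℷ + ε x in the deformed relation, move all fractions to the
left and collect powers of ε (`braid_of_deformed`). Everything other than the two triple products of
ℷ's cancels by the formula for ℷ² and the identity x₁₂x₂₃ + x₁₃x₁₂ + x₂₃x₁₃ = -1
(`cyclic_sum_eq_neg_one`), used also with the indices reversed. -/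

noncomputable section

namespace SpinAffineHecke

/-! ### Identities in an arbitrary algebra -/

section Abstract

variable {F A : Type*} [Field F] [Ring A] [Algebra F A]

/-- The relation for `r * t`, which follows from the other relations. -/
theorem mul_q_hi_aux (h2' : (2 : F) ≠ 0) {e : F} {r a b s t : A}
    (h1 : r * a = b * r + e • (s - t)) (h1' : r * b = a * r - e • (s - t))
    (h2 : r * s = -(t * r) - e • (a + b)) (h3 : r * r = (-e ^ 2 - 2) • (1 : A)) :
    r * t = -(s * r) - e • (a + b) := by
  have hz : ∀ z : A, z * r * r = (-e ^ 2 - 2) • z := fun z => by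
    rw [mul_assoc, h3, mul_smul_comm, mul_one]
  have hz' : ∀ z : A, r * (r * z) = (-e ^ 2 - 2) • z := fun z => by
    rw [← mul_assoc, h3, smul_mul_assoc, one_mul]
  obtain ⟨V, hV⟩ : ∃ V, V = r * t + s * r + e • (a + b) := ⟨_, rfl⟩
  have e2 := hz' s
  rw [h2, mul_sub, mul_neg, mul_smul_comm, mul_add, h1, h1', ← mul_assoc] at e2
  -- Both sides come from r(rs): the terms ±e(s - t) produced by r(a + b) cancel.
  have f1 : V * r = 0 := by
    rw [hV, add_mul, add_mul, hz, ← e2, smul_mul_assoc, add_mul]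
    module
  -- Expanding r(ra) leaves -eV as the only surplus term.
  have f2 : e • V = 0 := by
    have e1 := hz' a
    rw [h1, mul_add, mul_smul_comm, mul_sub, h2, ← mul_assoc, h1', sub_mul, mul_assoc, h3,
      smul_mul_assoc, sub_mul, mul_smul_comm, mul_one] at e1
    rw [hV]
    linear_combination (norm := module) -e1
  -- V r² = 0 says (-e² - 2)V = 0; since eV = 0, this leaves 2V = 0.
  have f3 := hz V
  rw [f1, zero_mul] at f3
  have f4 : (2 : F) • V = 0 := by
    linear_combination (norm := module) f3 - e • f2
  have f5 : V = 0 := (smul_eq_zero.mp f4).resolve_left h2'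
  rw [hV] at f5
  linear_combination (norm := module) f5

variable {e : F} {r a b s t : A} {d : Aˣ}

theorem gimel_mul_p_lo_aux (hd : (d : A) = a - b) (h1 : r * a = b * r + e • (s - t))
    (hab : Commute a b) (has : Commute a s) (hat : Commute a t) :
    (r - e • (((d⁻¹ : Aˣ) : A) * (s - t))) * a = b * (r - e • (((d⁻¹ : Aˣ) : A) * (s - t))) := by
  have hdb : Commute ((d⁻¹ : Aˣ) : A) b :=
    Commute.units_inv_left (by rw [hd]; exact hab.sub_left (Commute.refl b))
  have key : ((d⁻¹ : Aˣ) : A) * (s - t) * a = s - t + b * (((d⁻¹ : Aˣ) : A) * (s - t)) := by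
    have : a = d + b := by rw [hd]; abel
    rw [mul_assoc, ← (has.sub_right hat).eq, this, add_mul, mul_add, Units.inv_mul_cancel_left,
      ← mul_assoc, ← mul_assoc b, hdb.eq]
  rw [sub_mul, h1, smul_mul_assoc, key, mul_sub b, mul_smul_comm]
  module

/-- The exchange a ↔ b, s ↔ t, d ↦ -d fixes the fraction d⁻¹(s - t), so this is the mirror image of
`gimel_mul_p_lo_aux`. -/
theorem gimel_mul_p_hi_aux (hd : (d : A) = a - b) (h1 : r * b = a * r - e • (s - t))
    (hab : Commute a b) (hbs : Commute b s) (hbt : Commute b t) :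
    (r - e • (((d⁻¹ : Aˣ) : A) * (s - t))) * b = a * (r - e • (((d⁻¹ : Aˣ) : A) * (s - t))) := by
  have h := gimel_mul_p_lo_aux (r := r) (a := b) (b := a) (s := t) (t := s) (e := e) (d := -d)
    (by rw [Units.val_neg, hd]; abel) (by rw [h1]; module) hab.symm hbt hbs
  have hx : ((((-d)⁻¹ : Aˣ) : A)) * (t - s) = ((d⁻¹ : Aˣ) : A) * (s - t) := by
    rw [inv_neg, Units.val_neg]; noncomm_ring
  rwa [hx] at h

theorem gimel_mul_q_lo_aux (hd : (d : A) = a - b) (h2 : r * s = -(t * r) - e • (a + b))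
    (hab : Commute a b) (hat : Commute a t) (hbt : Commute b t)
    (hs : a ^ 2 + s ^ 2 = 1) (ht : b ^ 2 + t ^ 2 = 1) :
    (r - e • (((d⁻¹ : Aˣ) : A) * (s - t))) * s =
      -(t * (r - e • (((d⁻¹ : Aˣ) : A) * (s - t)))) := by
  have hdt : Commute ((d⁻¹ : Aˣ) : A) t :=
    Commute.units_inv_left (by rw [hd]; exact hat.sub_left hbt)
  -- With d⁻¹ in front, the numerator (s - t)s + t(s - t) telescopes to s² - t² = b² - a², without
  -- any commutation of s and t.
  have key : ((d⁻¹ : Aˣ) : A) * (s - t) * s + t * (((d⁻¹ : Aˣ) : A) * (s - t)) = -(a + b) := by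
    rw [← mul_assoc t, ← hdt.eq, mul_assoc, mul_assoc, ← mul_add, Units.inv_mul_eq_iff_eq_mul, hd]
    have h5 : s * s = 1 - a * a := by rw [← sq, ← sq, ← hs]; abel
    have h6 : t * t = 1 - b * b := by rw [← sq, ← sq, ← ht]; abel
    rw [sub_mul, mul_sub, h5, h6, mul_neg, sub_mul, mul_add, mul_add, hab.eq]
    abel
  rw [sub_mul, h2, mul_sub t, smul_mul_assoc, mul_smul_comm]
  linear_combination (norm := module) -e • key

theorem gimel_mul_q_hi_aux (hd : (d : A) = a - b) (h2 : r * t = -(s * r) - e • (a + b))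
    (hab : Commute a b) (has : Commute a s) (hbs : Commute b s)
    (hs : a ^ 2 + s ^ 2 = 1) (ht : b ^ 2 + t ^ 2 = 1) :
    (r - e • (((d⁻¹ : Aˣ) : A) * (s - t))) * t =
      -(s * (r - e • (((d⁻¹ : Aˣ) : A) * (s - t)))) := by
  have h := gimel_mul_q_lo_aux (r := r) (a := b) (b := a) (s := t) (t := s) (e := e) (d := -d)
    (by rw [Units.val_neg, hd]; abel) (by rw [h2, add_comm b]) hab.symm hbs has ht hs
  have hx : ((((-d)⁻¹ : Aˣ) : A)) * (t - s) = ((d⁻¹ : Aˣ) : A) * (s - t) := by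
    rw [inv_neg, Units.val_neg]; noncomm_ring
  rwa [hx] at h

/-- The square of `(a - b)⁻¹ (s - t)`. -/
theorem inv_mul_sub_sq (hd : (d : A) = a - b) (has : Commute a s) (hat : Commute a t)
    (hbs : Commute b s) (hbt : Commute b t) (hst : s * t = -(t * s))
    (hs : a ^ 2 + s ^ 2 = 1) (ht : b ^ 2 + t ^ 2 = 1) :
    (((d⁻¹ : Aˣ) : A) * (s - t)) * (((d⁻¹ : Aˣ) : A) * (s - t)) =
      (((d ^ 2)⁻¹ : Aˣ) : A) * (2 - a * a - b * b) := by
  have hdst : Commute ((d⁻¹ : Aˣ) : A) (s - t) :=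
    Commute.units_inv_left (by rw [hd]; exact (has.sub_left hbs).sub_right (hat.sub_left hbt))
  have h5 : s * s = 1 - a * a := by rw [← sq, ← sq, ← hs]; abel
  have h6 : t * t = 1 - b * b := by rw [← sq, ← sq, ← ht]; abel
  have h7 : (s - t) * (s - t) = 2 - a * a - b * b := by
    rw [sub_mul, mul_sub, mul_sub, h5, h6, hst, ← one_add_one_eq_two]; abel
  rw [mul_assoc, ← mul_assoc (s - t), ← hdst.eq, mul_assoc _ (s - t), h7, ← mul_assoc, ← inv_pow,
    sq, Units.val_mul]

/-- If `g = r - e x` anticommutes with `x`, then `g² = r² - e² x²`. -/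
theorem sub_smul_sq {g x : A} (hg : r = g + e • x) (hgx : g * x = -(x * g)) :
    g * g = r * r - e ^ 2 • (x * x) := by
  rw [hg]
  simp only [mul_add, add_mul, smul_mul_assoc, mul_smul_comm, hgx]
  module

/-- Used to bring products of two inverses to a common denominator. -/
theorem inv_mul_inv_eq_of_commute {G : Type*} [Group G] {x y z : G} (hxy : Commute x y)
    (hz : Commute (x * y) z) : x⁻¹ * y⁻¹ = (x * y * z)⁻¹ * z := by
  rw [hz.eq, mul_inv_rev, inv_mul_cancel_right, hxy.eq, mul_inv_rev]

/-- The combination of the squares of `r` and `x` in `r - e x`, for a fraction `x`. -/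
theorem scalar_sub_inv_mul_eq {e : F} {a b : A} {d : Aˣ} (hd : (d : A) = a - b)
    (hab : Commute a b) :
    (-e ^ 2 - 2) • (1 : A) - e ^ 2 • ((((d ^ 2)⁻¹ : Aˣ) : A) * (2 - a * a - b * b)) =
      -2 + (2 * e ^ 2) • ((((d ^ 2)⁻¹ : Aˣ) : A) * (a * b - 1)) := by
  have h2 : (2 : A) = (2 : F) • (1 : A) := by rw [two_smul, one_add_one_eq_two]
  -- This is d⁻²(a - b)² = 1; it puts the scalar -e² over the denominator d².
  have h : (((d ^ 2)⁻¹ : Aˣ) : A) * (a * a + b * b - (2 : F) • (a * b)) = 1 := by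
    rw [Units.inv_mul_eq_iff_eq_mul, mul_one, Units.val_pow_eq_pow_val, hd, sq, sub_mul,
      mul_sub, mul_sub, hab.eq]
    module
  rw [h2]
  simp only [mul_sub, mul_add, mul_smul_comm, mul_one] at h ⊢
  linear_combination (norm := module) e ^ 2 • h

theorem sub_smul_mul_eq_neg {e : F} {x y z : A} (hx : x * z = -(z * x)) (hy : y * z = -(z * y)) :
    (x - e • y) * z = -(z * (x - e • y)) := by
  rw [sub_mul, mul_sub, smul_mul_assoc, mul_smul_comm, hx, hy, smul_neg]
  abel

/-- A rational identity in three commuting and three anticommuting variables. -/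
theorem cyclic_sum_eq_neg_one {a b c s t u : A} {d₁ d₂ d₃ : Aˣ}
    (h₁ : (d₁ : A) = a - b) (h₂ : (d₂ : A) = b - c) (h₃ : (d₃ : A) = a - c)
    (hab : Commute a b) (hac : Commute a c) (hbc : Commute b c)
    (has : Commute a s) (hat : Commute a t) (hau : Commute a u)
    (hbs : Commute b s) (hbt : Commute b t) (hbu : Commute b u)
    (hcs : Commute c s) (hct : Commute c t) (hcu : Commute c u)
    (hts : t * s = -(s * t)) (hus : u * s = -(s * u)) (hut : u * t = -(t * u))
    (hs : a ^ 2 + s ^ 2 = 1) (ht : b ^ 2 + t ^ 2 = 1) (hu : c ^ 2 + u ^ 2 = 1) :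
    ((d₁⁻¹ : Aˣ) : A) * (s - t) * (((d₂⁻¹ : Aˣ) : A) * (t - u)) +
      ((d₃⁻¹ : Aˣ) : A) * (s - u) * (((d₁⁻¹ : Aˣ) : A) * (s - t)) +
      ((d₂⁻¹ : Aˣ) : A) * (t - u) * (((d₃⁻¹ : Aˣ) : A) * (s - u)) = -1 := by
  have hss : s * s = 1 - a * a := by rw [← sq, ← sq, ← hs]; abel
  have htt : t * t = 1 - b * b := by rw [← sq, ← sq, ← ht]; abel
  have huu : u * u = 1 - c * c := by rw [← sq, ← sq, ← hu]; abel
  have c₁₂ : Commute d₁ d₂ := Units.ext (by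
    rw [Units.val_mul, Units.val_mul, h₁, h₂]
    exact (hab.sub_right hac).sub_left ((Commute.refl b).sub_right hbc))
  have c₁₃ : Commute d₁ d₃ := Units.ext (by
    rw [Units.val_mul, Units.val_mul, h₁, h₃]
    exact ((Commute.refl a).sub_right hac).sub_left (hab.symm.sub_right hbc))
  have c₂₃ : Commute d₂ d₃ := Units.ext (by
    rw [Units.val_mul, Units.val_mul, h₂, h₃]
    exact (hab.symm.sub_right hbc).sub_left (hac.symm.sub_right (Commute.refl c)))
  have m₁ : Commute ((d₁⁻¹ : Aˣ) : A) (s - u) :=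
    Commute.units_inv_left (by rw [h₁]; exact (has.sub_left hbs).sub_right (hau.sub_left hbu))
  have m₂ : Commute ((d₂⁻¹ : Aˣ) : A) (s - t) :=
    Commute.units_inv_left (by rw [h₂]; exact (hbs.sub_left hcs).sub_right (hbt.sub_left hct))
  have m₃ : Commute ((d₃⁻¹ : Aˣ) : A) (t - u) :=
    Commute.units_inv_left (by rw [h₃]; exact (hat.sub_left hct).sub_right (hau.sub_left hcu))
  have k₁ : ((d₁⁻¹ : Aˣ) : A) * ((d₂⁻¹ : Aˣ) : A) = (((d₁ * d₂ * d₃)⁻¹ : Aˣ) : A) * d₃ := by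
    rw [← Units.val_mul, inv_mul_inv_eq_of_commute c₁₂ (c₁₃.mul_left c₂₃), Units.val_mul]
  have k₂ : ((d₃⁻¹ : Aˣ) : A) * ((d₁⁻¹ : Aˣ) : A) = (((d₁ * d₂ * d₃)⁻¹ : Aˣ) : A) * d₂ := by
    rw [← Units.val_mul, inv_mul_inv_eq_of_commute c₁₃.symm (c₂₃.symm.mul_left c₁₂), Units.val_mul,
      c₁₃.symm.eq, mul_assoc, c₂₃.symm.eq, mul_assoc]
  have k₃ : ((d₂⁻¹ : Aˣ) : A) * ((d₃⁻¹ : Aˣ) : A) = (((d₁ * d₂ * d₃)⁻¹ : Aˣ) : A) * d₁ := by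
    rw [← Units.val_mul, inv_mul_inv_eq_of_commute c₂₃ (c₁₂.symm.mul_left c₁₃.symm), Units.val_mul,
      ← (c₁₂.mul_right c₁₃).eq, mul_assoc]
  -- Clear the common denominator d₁d₂d₃. In the numerator the mixed products of s, t, u carry the
  -- factor d₃ - d₁ - d₂ = 0, and the squares contribute b²(a - c) - a²(b - c) - c²(a - b) = -(a -
  -- b)(b - c)(a - c).
  rw [m₂.symm.mul_mul_mul_comm, m₁.symm.mul_mul_mul_comm, m₃.symm.mul_mul_mul_comm, k₁, k₂, k₃,
    mul_assoc _ (d₃ : A), mul_assoc _ (d₂ : A), mul_assoc _ (d₁ : A), ← mul_add, ← mul_add,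
    Units.inv_mul_eq_iff_eq_mul, Units.val_mul, Units.val_mul, h₁, h₂, h₃]
  have left : ∀ {x y : A}, Commute x y → ∀ z, y * (x * z) = x * (y * z) := fun h z => by
    rw [← mul_assoc, ← h.eq, mul_assoc]
  simp only [mul_sub, sub_mul, mul_assoc, hss, htt, huu, hts, hus, hut,
    mul_neg, mul_one, ← hab.eq, ← hac.eq, ← hbc.eq, left hab, left hac, left hbc]
  abel

/-- The braid relation for elements obtained from a deformed one by subtracting `e x`, `e y`. -/
theorem braid_of_deformed {r w g h x y z : A} (hg : r = g + e • x) (hh : w = h + e • y)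
    (hb : r * w * r - w * r * w = e ^ 2 • (w - r))
    (hrw : r * r = w * w)
    (gx : g * x = -(x * g)) (gy : g * y = -(z * g)) (gz : g * z = -(y * g))
    (hx : h * x = -(z * h)) (hy : h * y = -(y * h)) (hz : h * z = -(x * h))
    (c₁ : x * y + z * x + y * z = -1) (c₂ : y * x + z * y + x * z = -1)
    (hyz : y * y * z = z * (y * y)) :
    g * h * g = h * g * h := by
  have hgg := sub_smul_sq hg gx
  have hhh := sub_smul_sq hh hy
  have gz' : ∀ v, g * (z * v) = -(y * (g * v)) := fun v => by
    rw [← mul_assoc, gz, neg_mul, mul_assoc]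
  have hz' : ∀ v, h * (z * v) = -(x * (h * v)) := fun v => by
    rw [← mul_assoc, hz, neg_mul, mul_assoc]
  have c₁g := congrArg (· * g) c₁
  have c₂h := congrArg (· * h) c₂
  have c₁x := congrArg (· * x) c₁
  have c₁y := congrArg (y * ·) c₁
  -- The part of order e in the expansion reduces to -z(g² - h²). As r² = w², the difference g² - h²
  -- is itself of order e², so this part moves to order e³.
  have zd : z * (g * g) - z * (h * h) = e ^ 2 • (z * (y * y) - z * (x * x)) := by
    rw [hgg, hhh, hrw]
    simp only [mul_sub, mul_smul_comm]
    module
  rw [hg, hh] at hb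
  simp only [mul_add, add_mul, smul_mul_assoc, mul_smul_comm, mul_assoc, gx, gy, gz', hx, hy,
    hz', mul_neg, neg_mul, neg_neg, smul_neg, one_mul, mul_one]
    at hb c₁g c₂h c₁x c₁y hyz ⊢
  -- At order e², `c₁g` and `c₂h` turn the coefficients of g and h into those on the right of the
  -- deformed relation. At order e³, the identity multiplied by x on the right and by y on the left
  -- gives xyx - yxy + zx² - y²z = y - x, and `hyz` matches y²z with zy².
  linear_combination (norm := module) hb + e • zd - e ^ 2 • (c₁g - c₂h) - e ^ 3 • (c₁x - c₁y + hyz)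

end Abstract

/-! ### The defining relations in the localization -/

variable {n : ℕ}

theorem toLoc_smul (k : K) (x : H n) : toLoc n (k • x) = k • toLoc n x :=
  (OreLocalization.smul_oreDiv_one k x).symm

theorem p'_comm (i j : Fin n) : Commute (p' i) (p' j) :=
  (show Commute (p i) (p j) from p_comm i j).map (toLoc n)

theorem p'_q' (i j : Fin n) : Commute (p' i) (q' j) :=
  (show Commute (p i) (q j) from p_q i j).map (toLoc n)

theorem q'_anticomm {i j : Fin n} (h : i ≠ j) : q' i * q' j = -(q' j * q' i) := by
  have h1 : q i * q j = -(q j * q i) := by simpa [q] using mk_rel (Rel.q_anticomm i j h)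
  simpa [q'] using congrArg (toLoc n) h1

theorem p'_sq_add_q'_sq (i : Fin n) : p' i ^ 2 + q' i ^ 2 = 1 := by
  have h1 : p i ^ 2 + q i ^ 2 = 1 := by simpa [p, q] using mk_rel (Rel.p_sq_add_q_sq i)
  simpa [p', q'] using congrArg (toLoc n) h1

theorem R'_mul_self (i : Fin (n - 1)) : R' i * R' i = (-ε ^ 2 - 2) • (1 : HLoc n) := by
  have h1 := congrArg (toLoc n) (R_sq i)
  rwa [Algebra.algebraMap_eq_smul_one, toLoc_smul, map_one, sq, map_mul] at h1

theorem R'_far {i j : Fin (n - 1)} (h : Far i j) : R' i * R' j = -(R' j * R' i) := by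
  have h1 : R i * R j = -(R j * R i) := by simpa [R] using mk_rel (Rel.R_far i j h)
  simpa [R'] using congrArg (toLoc n) h1

theorem R'_braid {i j : Fin (n - 1)} (h : (j : ℕ) = i + 1) :
    R' i * R' j * R' i - R' j * R' i * R' j = ε ^ 2 • (R' j - R' i) := by
  have h1 : R i * R j * R i - R j * R i * R j = ε ^ 2 • (R j - R i) := by
    simpa [R] using mk_rel (Rel.R_braid i j h)
  simpa [R', toLoc_smul] using congrArg (toLoc n) h1

theorem R'_p'_far {i : Fin (n - 1)} {j : Fin n} (h : j ≠ lo i) (h' : j ≠ hi i) :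
    Commute (R' i) (p' j) :=
  (show Commute (R i) (p j) from R_p_far i j h h').map (toLoc n)

theorem R'_q'_far {i : Fin (n - 1)} {j : Fin n} (h : j ≠ lo i) (h' : j ≠ hi i) :
    R' i * q' j = -(q' j * R' i) := by
  have h1 : R i * q j = -(q j * R i) := by simpa [R, q] using mk_rel (Rel.R_q_far i j h h')
  simpa [R', q'] using congrArg (toLoc n) h1

theorem R'_p'_lo (i : Fin (n - 1)) :
    R' i * p' (lo i) = p' (hi i) * R' i + ε • (q' (lo i) - q' (hi i)) := by
  simpa [R', p', q', toLoc_smul] using congrArg (toLoc n) (R_p i)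

theorem R'_p'_hi (i : Fin (n - 1)) :
    R' i * p' (hi i) = p' (lo i) * R' i - ε • (q' (lo i) - q' (hi i)) := by
  simpa [R', p', q', toLoc_smul] using congrArg (toLoc n) (R_mul_p_hi i)

theorem R'_q'_lo (i : Fin (n - 1)) :
    R' i * q' (lo i) = -(q' (hi i) * R' i) - ε • (p' (lo i) + p' (hi i)) := by
  simpa [R', p', q', toLoc_smul] using congrArg (toLoc n) (R_q i)

theorem R'_q'_hi (i : Fin (n - 1)) :
    R' i * q' (hi i) = -(q' (lo i) * R' i) - ε • (p' (lo i) + p' (hi i)) :=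
  mul_q_hi_aux two_ne_zero (R'_p'_lo i) (R'_p'_hi i) (R'_q'_lo i) (R'_mul_self i)

/-! ### Intertwiners against the p's, the q's and the fractions -/

theorem lo_ne_hi (i : Fin (n - 1)) : lo i ≠ hi i := (lo_lt_hi i).ne

/-- The correction term `(p_i - p_{i+1})⁻¹ (q_i - q_{i+1})` of the intertwiner. -/
def corr (i : Fin (n - 1)) : HLoc n :=
  ((diff i)⁻¹ : (HLoc n)ˣ) * (q' (lo i) - q' (hi i))

theorem R'_eq (i : Fin (n - 1)) : R' i = gimel i + ε • corr i := (sub_add_cancel _ _).symm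

theorem gimel_p'_lo (i : Fin (n - 1)) : gimel i * p' (lo i) = p' (hi i) * gimel i :=
  gimel_mul_p_lo_aux (diff_val i) (R'_p'_lo i) (p'_comm _ _) (p'_q' _ _) (p'_q' _ _)

theorem gimel_p'_hi (i : Fin (n - 1)) : gimel i * p' (hi i) = p' (lo i) * gimel i :=
  gimel_mul_p_hi_aux (diff_val i) (R'_p'_hi i) (p'_comm _ _) (p'_q' _ _) (p'_q' _ _)

theorem gimel_q'_lo (i : Fin (n - 1)) : gimel i * q' (lo i) = -(q' (hi i) * gimel i) :=
  gimel_mul_q_lo_aux (diff_val i) (R'_q'_lo i) (p'_comm _ _) (p'_q' _ _) (p'_q' _ _)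
    (p'_sq_add_q'_sq _) (p'_sq_add_q'_sq _)

theorem gimel_q'_hi (i : Fin (n - 1)) : gimel i * q' (hi i) = -(q' (lo i) * gimel i) :=
  gimel_mul_q_hi_aux (diff_val i) (R'_q'_hi i) (p'_comm _ _) (p'_q' _ _) (p'_q' _ _)
    (p'_sq_add_q'_sq _) (p'_sq_add_q'_sq _)

theorem commute_diff_inv {i : Fin (n - 1)} {z : HLoc n} (h : Commute (p' (lo i)) z)
    (h' : Commute (p' (hi i)) z) : Commute (((diff i)⁻¹ : (HLoc n)ˣ) : HLoc n) z :=
  Commute.units_inv_left (by rw [diff_val]; exact h.sub_left h')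

theorem corr_p' (i : Fin (n - 1)) (j : Fin n) : Commute (corr i) (p' j) :=
  (commute_diff_inv (p'_comm _ _) (p'_comm _ _)).mul_left
    ((p'_q' _ _).symm.sub_left (p'_q' _ _).symm)

/-- An element commuting with the `p`'s of index `i`, `i + 1` and anticommuting with the `q`'s
anticommutes with the correction term. -/
theorem mul_corr_eq_neg {i : Fin (n - 1)} {z : HLoc n} (h : Commute (p' (lo i)) z)
    (h' : Commute (p' (hi i)) z) (hq : z * q' (lo i) = -(q' (lo i) * z))
    (hq' : z * q' (hi i) = -(q' (hi i) * z)) : z * corr i = -(corr i * z) := by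
  rw [corr, ← mul_assoc, ← (commute_diff_inv h h').eq, mul_assoc, mul_sub, hq, hq', mul_assoc,
    sub_mul, neg_sub_neg, ← mul_neg, neg_sub]

theorem corr_q'_far {i : Fin (n - 1)} {j : Fin n} (h : j ≠ lo i) (h' : j ≠ hi i) :
    corr i * q' j = -(q' j * corr i) := by
  rw [mul_corr_eq_neg (p'_q' _ _) (p'_q' _ _) (q'_anticomm h) (q'_anticomm h'), neg_neg]

theorem gimel_p'_far {i : Fin (n - 1)} {j : Fin n} (h : j ≠ lo i) (h' : j ≠ hi i) :
    Commute (gimel i) (p' j) :=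
  (R'_p'_far h h').sub_left ((corr_p' i j).smul_left ε)

theorem gimel_q'_far {i : Fin (n - 1)} {j : Fin n} (h : j ≠ lo i) (h' : j ≠ hi i) :
    gimel i * q' j = -(q' j * gimel i) :=
  sub_smul_mul_eq_neg (R'_q'_far h h') (corr_q'_far h h')

/-- How an intertwiner moves past a fraction `(p_k - p_l)⁻¹ (q_k - q_l)`. -/
theorem gimel_mul_fraction {i : Fin (n - 1)} {d d' : (HLoc n)ˣ} {k l k' l' : Fin n}
    (hd : (d : HLoc n) = p' k - p' l) (hd' : (d' : HLoc n) = p' k' - p' l')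
    (hp : gimel i * p' k = p' k' * gimel i) (hp' : gimel i * p' l = p' l' * gimel i)
    (hq : gimel i * q' k = -(q' k' * gimel i)) (hq' : gimel i * q' l = -(q' l' * gimel i)) :
    gimel i * (((d⁻¹ : (HLoc n)ˣ) : HLoc n) * (q' k - q' l)) =
      -((((d'⁻¹ : (HLoc n)ˣ) : HLoc n) * (q' k' - q' l')) * gimel i) := by
  have h : SemiconjBy (gimel i) (d : HLoc n) d' := by
    rw [hd, hd']
    exact SemiconjBy.sub_right hp hp'
  rw [← mul_assoc, h.units_inv_right.eq, mul_assoc, mul_sub, hq, hq', mul_assoc, sub_mul, neg_sub_neg,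
    ← mul_neg, neg_sub]

/-- The transposition of i and i + 1 changes the sign of both numerator and denominator of the
correction, hence fixes it; only the sign from the q's remains. -/
theorem gimel_corr (i : Fin (n - 1)) : gimel i * corr i = -(corr i * gimel i) := by
  have h := gimel_mul_fraction (d := diff i) (d' := -diff i) (diff_val i)
    (by rw [Units.val_neg, diff_val, neg_sub]) (gimel_p'_lo i) (gimel_p'_hi i) (gimel_q'_lo i)
    (gimel_q'_hi i)
  have hx : (((-diff i)⁻¹ : (HLoc n)ˣ) : HLoc n) * (q' (hi i) - q' (lo i)) = corr i := by
    rw [inv_neg, Units.val_neg, neg_mul, ← mul_neg, neg_sub, corr]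
  rwa [hx] at h

/-! ### Quadratic, far and braid relations -/

theorem corr_mul_self (i : Fin (n - 1)) : corr i * corr i =
    (((diff i ^ 2)⁻¹ : (HLoc n)ˣ) : HLoc n) *
      (2 - p' (lo i) * p' (lo i) - p' (hi i) * p' (hi i)) :=
  inv_mul_sub_sq (diff_val i) (p'_q' _ _) (p'_q' _ _) (p'_q' _ _) (p'_q' _ _)
    (q'_anticomm (lo_ne_hi i)) (p'_sq_add_q'_sq _) (p'_sq_add_q'_sq _)

theorem gimel_sq (i : Fin (n - 1)) : gimel i ^ 2 =
    -2 + (2 * ε ^ 2) • ((((diff i) ^ 2)⁻¹ : (HLoc n)ˣ) * (p' (lo i) * p' (hi i) - 1)) := by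
  rw [sq, sub_smul_sq (R'_eq i) (gimel_corr i), R'_mul_self, corr_mul_self]
  exact scalar_sub_inv_mul_eq (diff_val i) (p'_comm _ _)

theorem gimel_far {i j : Fin (n - 1)} (h : Far i j) :
    gimel i * gimel j = -(gimel j * gimel i) := by
  have hij : (lo j ≠ lo i ∧ lo j ≠ hi i) ∧ (hi j ≠ lo i ∧ hi j ≠ hi i) := by
    simp only [Far, lt_abs] at h
    simp only [lo, hi, ne_eq, Fin.ext_iff]
    omega
  obtain ⟨⟨h1, h2⟩, h3, h4⟩ := hij
  -- The index pairs are disjoint, so each correction anticommutes with the other generator; the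
  -- corrections are subtracted one at a time, first from R_i and then from R_j.
  have e1 : gimel i * corr j = -(corr j * gimel i) :=
    mul_corr_eq_neg (gimel_p'_far h1 h2).symm (gimel_p'_far h3 h4).symm (gimel_q'_far h1 h2)
      (gimel_q'_far h3 h4)
  have e2 : R' j * corr i = -(corr i * R' j) :=
    mul_corr_eq_neg (R'_p'_far h1.symm h3.symm).symm (R'_p'_far h2.symm h4.symm).symm
      (R'_q'_far h1.symm h3.symm) (R'_q'_far h2.symm h4.symm)
  have e3 : gimel i * R' j = -(R' j * gimel i) :=
    sub_smul_mul_eq_neg (R'_far h) (neg_eq_iff_eq_neg.mp e2.symm)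
  exact neg_eq_iff_eq_neg.mp (sub_smul_mul_eq_neg (neg_eq_iff_eq_neg.mp e3.symm)
    (neg_eq_iff_eq_neg.mp e1.symm)).symm

theorem gimel_braid {i j : Fin (n - 1)} (h : (j : ℕ) = i + 1) :
    gimel i * gimel j * gimel i = gimel j * gimel i * gimel j := by
  have hj : lo j = hi i := Fin.ext h
  have h1 : lo i < hi i := lo_lt_hi i
  have h2 : hi i < hi j := hj ▸ lo_lt_hi j
  have h3 : lo i < hi j := h1.trans h2
  -- The third fraction has the non-adjacent denominator p_i - p_{i+2}, which is invertible because
  -- δ contains the factors for all pairs.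
  obtain ⟨d, hd⟩ : ∃ d : (HLoc n)ˣ, (d : HLoc n) = p' (lo i) - p' (hi j) := isUnit_p_sub h3
  have hdj : (diff j : HLoc n) = p' (hi i) - p' (hi j) := by rw [diff_val, hj]
  have hcj : corr j = ((diff j)⁻¹ : (HLoc n)ˣ) * (q' (hi i) - q' (hi j)) := by rw [corr, hj]
  have jp := gimel_p'_lo j
  have jq := gimel_q'_lo j
  have jp' := gimel_p'_hi j
  have jq' := gimel_q'_hi j
  rw [hj] at jp jq jp' jq'
  have ip : Commute (gimel i) (p' (hi j)) := gimel_p'_far h3.ne' h2.ne'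
  have iq : gimel i * q' (hi j) = -(q' (hi j) * gimel i) := gimel_q'_far h3.ne' h2.ne'
  have jp₀ : Commute (gimel j) (p' (lo i)) := gimel_p'_far (hj ▸ h1.ne) h3.ne
  have jq₀ : gimel j * q' (lo i) = -(q' (lo i) * gimel j) := gimel_q'_far (hj ▸ h1.ne) h3.ne
  refine braid_of_deformed (z := ((d⁻¹ : (HLoc n)ˣ) : HLoc n) * (q' (lo i) - q' (hi j)))
    (R'_eq i) (R'_eq j) (R'_braid h) ((R'_mul_self i).trans (R'_mul_self j).symm) (gimel_corr i)
    ?_ ?_ ?_ (gimel_corr j) ?_ ?_ ?_ ?_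
  · rw [hcj]
    exact gimel_mul_fraction hdj hd (gimel_p'_hi i) ip (gimel_q'_hi i) iq
  · rw [hcj]
    exact gimel_mul_fraction hd hdj (gimel_p'_lo i) ip (gimel_q'_lo i) iq
  · exact gimel_mul_fraction (diff_val i) hd jp₀ jp jq₀ jq
  · exact gimel_mul_fraction hd (diff_val i) jp₀ jp' jq₀ jq'
  · rw [hcj]
    exact cyclic_sum_eq_neg_one (diff_val i) hdj hd (p'_comm _ _) (p'_comm _ _) (p'_comm _ _)
      (p'_q' _ _) (p'_q' _ _) (p'_q' _ _) (p'_q' _ _) (p'_q' _ _) (p'_q' _ _) (p'_q' _ _)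
      (p'_q' _ _) (p'_q' _ _) (q'_anticomm h1.ne') (q'_anticomm h3.ne') (q'_anticomm h2.ne')
      (p'_sq_add_q'_sq _) (p'_sq_add_q'_sq _) (p'_sq_add_q'_sq _)
  -- The same identity with the indices in the order i + 2, i + 1, i: each fraction is unchanged,
  -- but the two adjacent ones trade places.
  · have key := cyclic_sum_eq_neg_one (d₁ := -diff j) (d₂ := -diff i) (d₃ := -d)
      (by rw [Units.val_neg, hdj, neg_sub]) (by rw [Units.val_neg, diff_val, neg_sub])
      (by rw [Units.val_neg, hd, neg_sub]) (p'_comm _ _) (p'_comm _ _) (p'_comm _ _)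
      (p'_q' _ _) (p'_q' _ _) (p'_q' _ _) (p'_q' _ _) (p'_q' _ _) (p'_q' _ _) (p'_q' _ _)
      (p'_q' _ _) (p'_q' _ _) (q'_anticomm h2.ne) (q'_anticomm h3.ne) (q'_anticomm h1.ne)
      (p'_sq_add_q'_sq _) (p'_sq_add_q'_sq _) (p'_sq_add_q'_sq _)
    simp only [inv_neg, Units.val_neg, neg_mul, ← mul_neg, neg_sub] at key
    rw [hcj]
    exact key
  -- The square of the correction is a function of the p's alone, so it commutes with every q.
  · have hc : ∀ k, Commute (corr j * corr j) (q' k) := fun k => by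
      have hp : ∀ k l m, Commute (p' k * p' l : HLoc n) (q' m) := fun k l m =>
        (p'_q' k m).mul_left (p'_q' l m)
      rw [corr_mul_self, ← inv_pow, Units.val_pow_eq_pow_val]
      exact ((commute_diff_inv (p'_q' _ _) (p'_q' _ _)).pow_left 2).mul_left
        (((Commute.ofNat_left _ _).sub_left (hp _ _ _)).sub_left (hp _ _ _))
    have hc' : Commute (corr j * corr j) (d : HLoc n) := by
      rw [hd]
      have := fun k => (corr_p' j k).mul_left (corr_p' j k)
      exact (this _).sub_right (this _)
    exact hc'.units_inv_right.mul_right ((hc _).sub_right (hc _))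

end SpinAffineHecke

end

theorem mainTheorem10 (n : ℕ) :
    (∀ i : Fin (n - 1),
      SpinAffineHecke.gimel i ^ 2 =
        -2 + (2 * SpinAffineHecke.ε ^ 2) •
          ((((SpinAffineHecke.diff i) ^ 2)⁻¹ : (SpinAffineHecke.HLoc n)ˣ) *
            (SpinAffineHecke.p' (SpinAffineHecke.lo i) *
              SpinAffineHecke.p' (SpinAffineHecke.hi i) - 1))) ∧
    (∀ i j : Fin (n - 1), (j : ℕ) = i + 1 →
      SpinAffineHecke.gimel i * SpinAffineHecke.gimel j * SpinAffineHecke.gimel i =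
        SpinAffineHecke.gimel j * SpinAffineHecke.gimel i * SpinAffineHecke.gimel j) ∧
    (∀ i j : Fin (n - 1), SpinAffineHecke.Far i j →
      SpinAffineHecke.gimel i * SpinAffineHecke.gimel j =
        -(SpinAffineHecke.gimel j * SpinAffineHecke.gimel i)) ∧
    (∀ i : Fin (n - 1),
      SpinAffineHecke.gimel i * SpinAffineHecke.p' (SpinAffineHecke.lo i) =
        SpinAffineHecke.p' (SpinAffineHecke.hi i) * SpinAffineHecke.gimel i ∧
      SpinAffineHecke.gimel i * SpinAffineHecke.p' (SpinAffineHecke.hi i) =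
        SpinAffineHecke.p' (SpinAffineHecke.lo i) * SpinAffineHecke.gimel i) ∧
    (∀ (i : Fin (n - 1)) (j : Fin n), j ≠ SpinAffineHecke.lo i → j ≠ SpinAffineHecke.hi i →
      SpinAffineHecke.gimel i * SpinAffineHecke.p' j =
        SpinAffineHecke.p' j * SpinAffineHecke.gimel i ∧
      SpinAffineHecke.gimel i * SpinAffineHecke.q' j =
        -(SpinAffineHecke.q' j * SpinAffineHecke.gimel i)) ∧
    (∀ i : Fin (n - 1),
      SpinAffineHecke.gimel i * SpinAffineHecke.q' (SpinAffineHecke.lo i) =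
        -(SpinAffineHecke.q' (SpinAffineHecke.hi i) * SpinAffineHecke.gimel i) ∧
      SpinAffineHecke.gimel i * SpinAffineHecke.q' (SpinAffineHecke.hi i) =
        -(SpinAffineHecke.q' (SpinAffineHecke.lo i) * SpinAffineHecke.gimel i)) := by
  exact ⟨SpinAffineHecke.gimel_sq, fun _ _ => SpinAffineHecke.gimel_braid,
    fun _ _ => SpinAffineHecke.gimel_far,
    fun i => ⟨SpinAffineHecke.gimel_p'_lo i, SpinAffineHecke.gimel_p'_hi i⟩,
    fun _ _ h h' => ⟨SpinAffineHecke.gimel_p'_far h h', SpinAffineHecke.gimel_q'_far h h'⟩,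
    fun i => ⟨SpinAffineHecke.gimel_q'_lo i, SpinAffineHecke.gimel_q'_hi i⟩⟩
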